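/- Let $l\ge 0$, $m\ge 0$ be integers and let $\{P_0,\dots,P_m\}$ be a symmetric Clifford system on $\mathbb{R}^{2l}$, i.e. real symmetric $2l\times 2l$ matrices with $P_\alpha P_\beta+P_\beta P_\alpha=2\delta_{\alpha\beta}I_{2l}$ for all $\alpha,\beta$. Let $S^{k-1}$ denote the unit sphere of $\mathbb{R}^{k}$ (so $S^{-1}=\emptyset$), and put $$M_i=\{x\in S^{2l-1}\mid \langle P_0x,x\rangle=\cdots=\langle P_ix,x\rangle=0\}\quad(0\le i\le m),$$ $$N_i=\{x\in S^{2l-1}\mid \langle P_0x,x\rangle^2+\cdots+\langle P_ix,x\rangle^2=1\}\quad(1\le i\le m).$$ (1) For every $0\le i\le m-1$ and each choice of sign, the set $U_{\pm1}=\{x\in M_i\mid \langle P_{i+1}x,x\rangle=\pm1\}$ is the image of $S^{l-1}$ under a linear isometric embedding $\mathbb{R}^l\to\mathbb{R}^{2l}$, and, with $U_{\pm1}$ so identified with $S^{l-1}$, the focal map $x\mapsto\frac{1}{\sqrt2}(x\pm P_{i+1}x)$ is a smooth locally trivial fibration $M_{i+1}\to U_{\pm 1}\cong S^{l-1}$ with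 fiber $S^{l-i-2}$. (2) For every $2\le i\le m$ and each choice of sign, the set $V_{\pm1}=\{x\in N_i\mid \langle P_{i}x,x\rangle=\pm1\}$ is the image of $S^{l-1}$ under a linear isometric embedding $\mathbb{R}^l\to\mathbb{R}^{2l}$, and, with $V_{\pm1}$ so identified with $S^{l-1}$, the focal map $x\mapsto\frac{1}{\sqrt2}(x\pm P_{i}x)$ is a smooth locally trivial fibration $N_{i-1}\to V_{\pm 1}\cong S^{l-1}$ with fiber $S^{i-1}$. Here a map $p:Z\to B$ between subsets of Euclidean spaces is a smooth locally trivial fibration with fiber $F$ if it is smooth and every $b\in B$ has an open neighbourhood $U\subset B$ with a diffeomorphism $p^{-1}(U)\to U\times F$ compatible with the projections to $U$. A map on a subset is smooth if it extends near each point of the subset to a $C^\infty$ map on an open set of the ambient space. -/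

import Mathlib

open scoped ContDiff

/-- Euclidean space `ℝⁿ` with its standard inner product. -/
abbrev Eucl (n : ℕ) : Type := EuclideanSpace ℝ (Fin n)

/-- The unit sphere `S^{n-1}` of `ℝⁿ`; in particular `S^{-1}`, the unit sphere of `ℝ⁰`, is empty. -/
def unitSphere (n : ℕ) : Set (Eucl n) := Metric.sphere 0 1

/-- `P₀, …, P_m` is a symmetric Clifford system on `ℝ^{2l}`: the `P_α` are symmetric matrices with
`P_α P_β + P_β P_α = 2 δ_{αβ} I`. -/
structure IsSymmetricCliffordSystem {l m : ℕ}
    (P : Fin (m + 1) → Matrix (Fin (2 * l)) (Fin (2 * l)) ℝ) : Prop where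
  symm : ∀ a, (P a).IsSymm
  anticomm : ∀ a b, P a * P b + P b * P a = (if a = b then (2 : ℝ) else 0) • 1

/-- The quadratic form `⟨A x, x⟩` of a real matrix `A`. -/
noncomputable def quadForm {n : ℕ} (A : Matrix (Fin n) (Fin n) ℝ) (x : Eucl n) : ℝ :=
  inner ℝ (Matrix.toEuclideanLin A x) x

/-- `M_i = {x ∈ S^{2l-1} | ⟨P₀ x, x⟩ = ⋯ = ⟨P_i x, x⟩ = 0}`. -/
def setM {l m : ℕ} (P : Fin (m + 1) → Matrix (Fin (2 * l)) (Fin (2 * l)) ℝ) (i : ℕ) :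
    Set (Eucl (2 * l)) :=
  {x | x ∈ unitSphere (2 * l) ∧ ∀ a : Fin (m + 1), (a : ℕ) ≤ i → quadForm (P a) x = 0}

/-- `N_i = {x ∈ S^{2l-1} | ⟨P₀ x, x⟩² + ⋯ + ⟨P_i x, x⟩² = 1}`. -/
def setN {l m : ℕ} (P : Fin (m + 1) → Matrix (Fin (2 * l)) (Fin (2 * l)) ℝ) (i : ℕ) :
    Set (Eucl (2 * l)) :=
  {x | x ∈ unitSphere (2 * l) ∧
    ∑ a ∈ Finset.univ.filter (fun a : Fin (m + 1) => (a : ℕ) ≤ i), quadForm (P a) x ^ 2 = 1}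

/-- The map `x ↦ (x + ε A x) / √2`; the two focal maps are the cases `ε = 1` and `ε = -1`. -/
noncomputable def focalMap {n : ℕ} (ε : ℝ) (A : Matrix (Fin n) (Fin n) ℝ) (x : Eucl n) : Eucl n :=
  (1 / Real.sqrt 2) • (x + ε • Matrix.toEuclideanLin A x)

/-- Smoothness of `f` on an arbitrary subset `s` of a normed space: near each point of `s`, `f`
agrees on `s` with a `C^∞` map defined on an open subset of the ambient space. -/
def SmoothOnSubset {E F : Type*} [NormedAddCommGroup E] [NormedSpace ℝ E]
    [NormedAddCommGroup F] [NormedSpace ℝ F] (f : E → F) (s : Set E) : Prop :=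
  ∀ x ∈ s, ∃ U : Set E, IsOpen U ∧ x ∈ U ∧
    ∃ g : E → F, ContDiffOn ℝ ∞ g U ∧ ∀ y ∈ s ∩ U, g y = f y

/-- `p` restricts to a smooth locally trivial fibration `Z → B` with fiber `F`, for subsets `Z`, `B`
and `F` of normed spaces. Only the values of `p` on `Z` matter. The set `B ∩ U` is an open
subset of `B`, and `Φ`, `Ψ` restrict to mutually inverse diffeomorphisms
between `Z ∩ p⁻¹(U)` and `(B ∩ U) × F`, compatible with the projections to `B ∩ U`.
When `B` and `F` are smooth submanifolds (such as spheres), these local trivializations make `Z` a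
smooth submanifold and `p` a smooth submersion. -/
structure IsSmoothFibration {E B' F' : Type*} [NormedAddCommGroup E] [NormedSpace ℝ E]
    [NormedAddCommGroup B'] [NormedSpace ℝ B'] [NormedAddCommGroup F'] [NormedSpace ℝ F']
    (p : E → B') (Z : Set E) (B : Set B') (F : Set F') : Prop where
  mapsTo : Set.MapsTo p Z B
  smooth : SmoothOnSubset p Z
  locallyTrivial : ∀ b ∈ B, ∃ U : Set B', IsOpen U ∧ b ∈ U ∧
    ∃ (Φ : E → B' × F') (Ψ : B' × F' → E),
      SmoothOnSubset Φ (Z ∩ p ⁻¹' U) ∧ SmoothOnSubset Ψ ((B ∩ U) ×ˢ F) ∧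
      Set.MapsTo Φ (Z ∩ p ⁻¹' U) ((B ∩ U) ×ˢ F) ∧
      Set.MapsTo Ψ ((B ∩ U) ×ˢ F) (Z ∩ p ⁻¹' U) ∧
      Set.InvOn Ψ Φ (Z ∩ p ⁻¹' U) ((B ∩ U) ×ˢ F) ∧
      ∀ z ∈ Z ∩ p ⁻¹' U, (Φ z).1 = p z

/-- The map `φ : Z → C` is a smooth fibration with fiber `F` over the unit sphere `S^{k-1}` of `ℝᵏ`,
where the subset `C` of a Euclidean space is identified with `S^{k-1}` by (the restriction of) a
linear isometric embedding `ι` of `ℝᵏ` that carries `S^{k-1}` onto `C`. -/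
def FibersOverSphere (k : ℕ) {n d : ℕ} (φ : Eucl n → Eucl n) (Z C : Set (Eucl n)) (F : Set (Eucl d)) :
    Prop :=
  ∃ ι : Eucl k →ₗᵢ[ℝ] Eucl n, ι '' unitSphere k = C ∧
    ∃ p : Eucl n → Eucl k, (∀ x ∈ Z, ι (p x) = φ x) ∧
      IsSmoothFibration p Z (unitSphere k) F

/-! Fix `A = P_a` and a sign `ε`. Any other member `P_b` anticommutes with `A` and so exchanges the
`±ε`-eigenspaces of `A`; both have dimension `l`. Write `x = (u + v)/√2`, where `u` and `v` are the
focal images of `x` for `ε` and `-ε`, lying in these two eigenspaces. A unit vector has `⟨Ax, x⟩ =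
0` exactly when `u` and `v` are unit vectors, and then `⟨P_b x, x⟩ = ⟨P_b u, v⟩`
(`inner_apply_of_eigen`). The focal map is `x ↦ u`, so its fiber is the set of admissible `v`.

For `M_{i+1}`, `v` runs over the unit vectors of the `-ε`-eigenspace orthogonal to the orthonormal
vectors `P_0 u, …, P_i u`. This is the sphere bundle of a vector bundle of rank `l - (i+1)`, the
range of a smooth family of projections (`normalProjection`). Intertwining nearby projections
trivializes it locally (`isSmoothFibration_of_idempotents`).

For `N_{i-1}`, put `c_j = ⟨P_j x, x⟩`. The condition `∑ c_j² = 1` forces `∑ c_j P_j x = x`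
(`opCombination_fixed`), hence `⟨Ax, x⟩ = 0` and `v = ∑ c_j P_j u`. So `x ↦ (u, c)` is a global
trivialization. -/

/-! ### Smooth maps on arbitrary subsets. -/

section Smooth

variable {E F G : Type*} [NormedAddCommGroup E] [NormedSpace ℝ E]
  [NormedAddCommGroup F] [NormedSpace ℝ F] [NormedAddCommGroup G] [NormedSpace ℝ G]

theorem ContDiffOn.smoothOnSubset {f : E → F} {U s : Set E} (hf : ContDiffOn ℝ ∞ f U)
    (hU : IsOpen U) (hs : s ⊆ U) : SmoothOnSubset f s :=
  fun _ hx => ⟨U, hU, hs hx, f, hf, fun _ _ => rfl⟩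

theorem ContDiff.smoothOnSubset {f : E → F} (hf : ContDiff ℝ ∞ f) (s : Set E) :
    SmoothOnSubset f s :=
  hf.contDiffOn.smoothOnSubset isOpen_univ (Set.subset_univ s)

theorem ContDiff.comp_smoothOnSubset {g : F → G} {f : E → F} {s : Set E}
    (hg : ContDiff ℝ ∞ g) (hf : SmoothOnSubset f s) : SmoothOnSubset (fun x => g (f x)) s := by
  intro x hx
  obtain ⟨U, hU, hxU, f', hf', h⟩ := hf x hx
  exact ⟨U, hU, hxU, fun y => g (f' y), hg.comp_contDiffOn hf',
    fun y hy => congrArg g (h y hy)⟩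

theorem SmoothOnSubset.prodMk {f : E → F} {g : E → G} {s : Set E}
    (hf : SmoothOnSubset f s) (hg : SmoothOnSubset g s) :
    SmoothOnSubset (fun x => (f x, g x)) s := by
  intro x hx
  obtain ⟨U, hU, hxU, f', hf', h⟩ := hf x hx
  obtain ⟨V, hV, hxV, g', hg', h'⟩ := hg x hx
  exact ⟨U ∩ V, hU.inter hV, ⟨hxU, hxV⟩, fun y => (f' y, g' y),
    (hf'.mono Set.inter_subset_left).prodMk (hg'.mono Set.inter_subset_right),
    fun y hy => Prod.ext (h y ⟨hy.1, hy.2.1⟩) (h' y ⟨hy.1, hy.2.2⟩)⟩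

end Smooth

/-! ### Sphere bundles of smooth families of idempotents. -/

section SphereBundle

variable {E F : Type*} [NormedAddCommGroup E] [InnerProductSpace ℝ E]
  [NormedAddCommGroup F] [InnerProductSpace ℝ F]

theorem smoothOnSubset_normalize {G : Type*} [NormedAddCommGroup G] [NormedSpace ℝ G] {f : G → E}
    {U s : Set G} (hf : ContDiffOn ℝ ∞ f U)
    (hU : IsOpen U) (hs : s ⊆ U) (h0 : ∀ x ∈ s, f x ≠ 0) :
    SmoothOnSubset (fun x => ‖f x‖⁻¹ • f x) s := by
  have hV : IsOpen (U ∩ f ⁻¹' {0}ᶜ) := hf.continuousOn.isOpen_inter_preimage hU isOpen_compl_singleton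
  refine ContDiffOn.smoothOnSubset (U := U ∩ f ⁻¹' {0}ᶜ) ?_ hV fun x hx => ⟨hs hx, h0 x hx⟩
  have hf' := hf.mono (Set.inter_subset_left (t := f ⁻¹' {0}ᶜ))
  exact ((hf'.norm ℝ fun x hx => hx.2).inv fun x hx => norm_ne_zero_iff.2 hx.2).smul hf'

theorem norm_inv_norm_smul {x : E} (hx : x ≠ 0) : ‖‖x‖⁻¹ • x‖ = 1 := by
  rw [norm_smul, norm_inv, norm_norm, inv_mul_cancel₀ (norm_ne_zero_iff.2 hx)]

theorem inv_norm_smul_smul {r : ℝ} (hr : 0 < r) {x : E} (hx : ‖x‖ = 1) :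
    ‖r • x‖⁻¹ • (r • x) = x := by
  rw [norm_smul, hx, mul_one, Real.norm_of_nonneg hr.le, smul_smul, inv_mul_cancel₀ hr.ne', one_smul]

theorem LinearIsometry.adjoint_apply_self [CompleteSpace E] {d : ℕ} (κ : Eucl d →ₗᵢ[ℝ] E)
    (c : Eucl d) : ContinuousLinearMap.adjoint κ.toContinuousLinearMap (κ c) = c := by
  refine ext_inner_right ℝ fun w => ?_
  rw [ContinuousLinearMap.adjoint_inner_left]
  exact κ.inner_map_map c w

/-- The intertwiner `Q Q₀ + (1 - Q)(1 - Q₀)` of two idempotents. -/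
noncomputable def idempotentIntertwiner (Q₀ Q : E →L[ℝ] E) : E →L[ℝ] E :=
  Q * Q₀ + (1 - Q) * (1 - Q₀)

theorem idempotentIntertwiner_self {Q : E →L[ℝ] E} (hQ : Q * Q = Q) :
    idempotentIntertwiner Q Q = 1 := by
  simp only [idempotentIntertwiner, mul_sub, sub_mul, hQ, one_mul, mul_one]
  abel

/-- Both sides equal `Q * Q₀`, because `Q * (1 - Q)` and `(1 - Q₀) * Q₀` vanish. When the
intertwiner is invertible it therefore carries the range of `Q₀` onto that of `Q`. -/
theorem mul_idempotentIntertwiner {Q₀ Q : E →L[ℝ] E} (hQ₀ : Q₀ * Q₀ = Q₀) (hQ : Q * Q = Q) :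
    Q * idempotentIntertwiner Q₀ Q = idempotentIntertwiner Q₀ Q * Q₀ := by
  simp only [idempotentIntertwiner, mul_add, add_mul, mul_assoc, mul_sub, sub_mul, hQ₀, one_mul,
    mul_one]
  simp only [← mul_assoc, hQ]
  abel

/-- The unit sphere bundle of the bundle of ranges of a smooth family of idempotents is a
smooth locally trivial fibration. -/
theorem isSmoothFibration_of_idempotents [CompleteSpace E] {Z' : Type*} [NormedAddCommGroup Z']
    [NormedSpace ℝ Z'] {d : ℕ} {Z : Set Z'} {B : Set F} {p : Z' → F} {q : Z' → E} {s : F × E → Z'}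
    {Q : F → E →L[ℝ] E} (hp : ContDiff ℝ ∞ p) (hq : ContDiff ℝ ∞ q) (hs : ContDiff ℝ ∞ s)
    (hQ : ContDiff ℝ ∞ Q) (hQQ : ∀ u ∈ B, Q u * Q u = Q u)
    (hrank : ∀ u ∈ B, ∃ κ : Eucl d →ₗᵢ[ℝ] E, ∀ y, Q u y = y ↔ ∃ c, κ c = y)
    (hZ : ∀ x ∈ Z, p x ∈ B ∧ Q (p x) (q x) = q x ∧ ‖q x‖ = 1 ∧ s (p x, q x) = x)
    (hS : ∀ u ∈ B, ∀ v, Q u v = v → ‖v‖ = 1 → s (u, v) ∈ Z ∧ p (s (u, v)) = u ∧ q (s (u, v)) = v) :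
    IsSmoothFibration p Z B (unitSphere d) := by
  refine ⟨fun x hx => (hZ x hx).1, hp.smoothOnSubset Z, fun b hb => ?_⟩
  obtain ⟨κ, hκ⟩ := hrank b hb
  -- `L b = 1`, so `L u` is invertible for `u` near `b` and identifies the fiber over `b` with the
  -- fiber over `u`. It need not be isometric, so both trivialization maps renormalize.
  set L : F → E →L[ℝ] E := fun u => idempotentIntertwiner (Q b) (Q u) with hL
  have hLsm : ContDiff ℝ ∞ L :=
    (hQ.clm_comp contDiff_const).add ((contDiff_const.sub hQ).clm_comp contDiff_const)
  have hLQ : ∀ u ∈ B, ∀ y, Q u (L u y) = L u (Q b y) := fun u hu y =>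
    DFunLike.congr_fun (mul_idempotentIntertwiner (hQQ b hb) (hQQ u hu)) y
  set U : Set F := {u | IsUnit (L u)} with hU
  have hUo : IsOpen U := Units.isOpen.preimage hLsm.continuous
  have hbU : b ∈ U := by
    simp only [hU, Set.mem_ofPred_eq, hL, idempotentIntertwiner_self (hQQ b hb), isUnit_one]
  have hLl : ∀ u ∈ U, ∀ y, Ring.inverse (L u) (L u y) = y := fun u hu y =>
    DFunLike.congr_fun (Ring.inverse_mul_cancel _ hu) y
  have hLr : ∀ u ∈ U, ∀ y, L u (Ring.inverse (L u) y) = y := fun u hu y =>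
    DFunLike.congr_fun (Ring.mul_inverse_cancel _ hu) y
  have hinv : ContDiffOn ℝ ∞ (fun u => Ring.inverse (L u)) U := by
    intro u hu
    obtain ⟨w, hw⟩ := hu
    have h1 : ContDiffAt ℝ ∞ Ring.inverse (L u) := hw ▸ contDiffAt_ringInverse ℝ w
    exact (h1.comp u hLsm.contDiffAt).contDiffWithinAt
  let κ' : E →L[ℝ] Eucl d := ContinuousLinearMap.adjoint κ.toContinuousLinearMap
  have hκ' : ∀ c, κ' (κ c) = c := κ.adjoint_apply_self
  let f : Z' → Eucl d := fun x => κ' (Ring.inverse (L (p x)) (q x))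
  let g : F × Eucl d → E := fun w => L w.1 (κ w.2)
  have hfκ : ∀ x ∈ Z, p x ∈ U → L (p x) (κ (f x)) = q x := by
    intro x hx hxU
    obtain ⟨hxB, hqx, -, -⟩ := hZ x hx
    have : Q b (Ring.inverse (L (p x)) (q x)) = Ring.inverse (L (p x)) (q x) := by
      rw [← hLl _ hxU (Q b _), ← hLQ _ hxB, hLr _ hxU, hqx]
    obtain ⟨c, hc⟩ := (hκ _).1 this
    have hfc : f x = c := by simp only [f, ← hc, hκ']
    rw [hfc, hc, hLr _ hxU]
  have hf0 : ∀ x ∈ Z ∩ p ⁻¹' U, f x ≠ 0 := by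
    intro x hx h0
    have h := hfκ x hx.1 hx.2
    have h1 := (hZ x hx.1).2.2.1
    rw [h0, map_zero, map_zero] at h
    rw [← h, norm_zero] at h1
    exact zero_ne_one h1
  have hgf : ∀ u ∈ U, ∀ c, κ' (Ring.inverse (L u) (g (u, c))) = c := by
    intro u hu c
    simp only [g, hLl u hu, hκ']
  have hg0 : ∀ w ∈ (B ∩ U) ×ˢ unitSphere d, g w ≠ 0 := by
    rintro ⟨u, c⟩ ⟨⟨-, hu⟩, hc⟩ h0
    have h := hgf u hu c
    rw [h0, map_zero, map_zero] at h
    simp [unitSphere, ← h] at hc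
  have hgQ : ∀ u ∈ B, ∀ c, Q u (g (u, c)) = g (u, c) := by
    intro u hu c
    simp only [g]
    rw [hLQ u hu, (hκ _).2 ⟨c, rfl⟩]
  have hΨ : ∀ w ∈ (B ∩ U) ×ˢ unitSphere d,
      s (w.1, ‖g w‖⁻¹ • g w) ∈ Z ∧ p (s (w.1, ‖g w‖⁻¹ • g w)) = w.1 ∧
        q (s (w.1, ‖g w‖⁻¹ • g w)) = ‖g w‖⁻¹ • g w := by
    intro w hw
    refine hS w.1 hw.1.1 _ ?_ (norm_inv_norm_smul (hg0 w hw))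
    rw [map_smul, hgQ w.1 hw.1.1 w.2]
  refine ⟨U, hUo, hbU, fun x => (p x, ‖f x‖⁻¹ • f x), fun w => s (w.1, ‖g w‖⁻¹ • g w),
    ?_, ?_, ?_, ?_, ⟨?_, ?_⟩, fun _ _ => rfl⟩
  · refine (hp.smoothOnSubset _).prodMk (smoothOnSubset_normalize (U := p ⁻¹' U) ?_
      (hUo.preimage hp.continuous) Set.inter_subset_right hf0)
    exact κ'.contDiff.comp_contDiffOn
      ((hinv.comp hp.contDiffOn fun _ h => h).clm_apply hq.contDiffOn)
  · refine hs.comp_smoothOnSubset ((contDiff_fst.smoothOnSubset _).prodMk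
      (smoothOnSubset_normalize (U := Set.univ) ?_ isOpen_univ (Set.subset_univ _) hg0))
    exact ((hLsm.comp contDiff_fst).clm_apply (κ.contDiff.comp contDiff_snd)).contDiffOn
  · intro x hx
    exact ⟨⟨(hZ x hx.1).1, hx.2⟩, by simpa [unitSphere] using norm_inv_norm_smul (hf0 x hx)⟩
  · intro w hw
    exact ⟨(hΨ w hw).1, by rw [Set.mem_preimage, (hΨ w hw).2.1]; exact hw.1.2⟩
  · intro x hx
    -- `g` is linear in the fiber variable, so renormalizing changes its value only by a positive
    -- factor, which the second normalization removes.
    have h : g (p x, ‖f x‖⁻¹ • f x) = ‖f x‖⁻¹ • q x := by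
      simp only [g, map_smul, hfκ x hx.1 hx.2]
    have h2 := (hZ x hx.1).2.2
    simp only [h]
    rw [inv_norm_smul_smul (inv_pos.2 (norm_pos_iff.2 (hf0 x hx))) h2.1, h2.2]
  · intro w hw
    obtain ⟨-, h2, h3⟩ := hΨ w hw
    have h : f (s (w.1, ‖g w‖⁻¹ • g w)) = ‖g w‖⁻¹ • w.2 := by
      simp only [f]
      rw [h2, h3, map_smul, map_smul, hgf w.1 hw.1.2 w.2]
    have hw2 : ‖w.2‖ = 1 := by simpa [unitSphere] using hw.2
    refine Prod.ext h2 ?_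
    simp only [h]
    exact inv_norm_smul_smul (inv_pos.2 (norm_pos_iff.2 (hg0 w hw))) hw2

end SphereBundle

/-! ### Anticommuting involutions and their eigenspaces. -/

section Clifford

variable {E : Type*} [NormedAddCommGroup E] [InnerProductSpace ℝ E]

theorem exists_linearIsometry_range [FiniteDimensional ℝ E] (K : Submodule ℝ E) {d : ℕ}
    (hd : Module.finrank ℝ K = d) : ∃ κ : Eucl d →ₗᵢ[ℝ] E, ∀ y, y ∈ K ↔ ∃ c, κ c = y := by
  let e := ((stdOrthonormalBasis ℝ K).reindex (finCongr hd)).repr.symm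
  refine ⟨K.subtypeₗᵢ.comp e.toLinearIsometry, fun y => ⟨fun hy => ⟨e.symm ⟨y, hy⟩, ?_⟩, ?_⟩⟩
  · simp
  · rintro ⟨c, rfl⟩
    exact (e c).2

/-- Symmetric involutions that anticommute pairwise. -/
structure IsCliffordFamily {ι : Type*} (T : ι → E →ₗ[ℝ] E) : Prop where
  symm : ∀ a x y, inner ℝ (T a x) y = inner ℝ x (T a y)
  sq : ∀ a x, T a (T a x) = x
  anticomm : ∀ a b, a ≠ b → ∀ x, T a (T b x) = -T b (T a x)

namespace IsCliffordFamily

variable {ι : Type*} {T : ι → E →ₗ[ℝ] E} (hT : IsCliffordFamily T)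
include hT

theorem inner_self_apply (a : ι) (x : E) : inner ℝ (T a x) (T a x) = inner ℝ x x := by
  rw [hT.symm, hT.sq]

/-- By symmetry and anticommutation `T a ∘ T b` is skew-symmetric, so its quadratic form vanishes.
-/
theorem inner_apply_apply {a b : ι} (hab : a ≠ b) (x : E) : inner ℝ (T a x) (T b x) = 0 := by
  have h := hT.symm a x (T b x)
  rw [hT.anticomm a b hab, inner_neg_right, ← hT.symm b x] at h
  have h' := real_inner_comm (T a x) (T b x)
  linarith

theorem inner_eq_zero {a : ι} {ε : ℝ} (hε : ε ≠ 0) {u v : E} (hu : T a u = ε • u)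
    (hv : T a v = -ε • v) : inner ℝ u v = 0 := by
  have h := hT.symm a u v
  rw [hu, hv, real_inner_smul_left, real_inner_smul_right] at h
  have : ε * inner ℝ u v = 0 := by linarith
  exact (mul_eq_zero.1 this).resolve_left hε

theorem apply_of_eigen {a b : ι} (hab : a ≠ b) {ε : ℝ} {u : E} (hu : T a u = ε • u) :
    T a (T b u) = -ε • T b u := by
  rw [hT.anticomm a b hab, hu, map_smul, neg_smul]

theorem inner_apply_self_of_eigen {a b : ι} (hab : a ≠ b) {ε : ℝ} (hε : ε ≠ 0) {u : E}
    (hu : T a u = ε • u) : inner ℝ (T b u) u = 0 := by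
  rw [real_inner_comm]
  exact hT.inner_eq_zero hε hu (hT.apply_of_eigen hab hu)

/-- The equality case of Cauchy–Schwarz: the value `ε` makes `‖T a x - ε • x‖²` equal to `1 - 2ε² +
ε² = 0`. -/
theorem inner_apply_self_eq_iff {a : ι} {ε : ℝ} (hε : ε * ε = 1) {x : E} (hx : ‖x‖ = 1) :
    inner ℝ (T a x) x = ε ↔ T a x = ε • x := by
  have hxx : inner ℝ x x = (1 : ℝ) := by rw [real_inner_self_eq_norm_sq, hx]; norm_num
  constructor
  · intro h
    rw [← sub_eq_zero, ← inner_self_eq_zero (𝕜 := ℝ)]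
    simp only [inner_sub_left, inner_sub_right, real_inner_smul_left, real_inner_smul_right,
      hT.inner_self_apply, real_inner_comm _ x, h, hxx]
    linarith
  · intro h
    rw [h, real_inner_smul_left, hxx, mul_one]

/-- `T b` maps each of the two eigenspaces of `T a` injectively into the other, so their dimensions
agree; as `T a` is an involution, they add up to the whole space. -/
theorem finrank_eigenspace [FiniteDimensional ℝ E] {l : ℕ} (hE : Module.finrank ℝ E = 2 * l)
    {a b : ι} (hab : a ≠ b) {ε : ℝ} (hε : ε * ε = 1) :
    Module.finrank ℝ (Module.End.eigenspace (T a) ε) = l := by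
  have hε0 : ε ≠ 0 := fun h => by simp [h] at hε
  have hle : ∀ δ : ℝ, Module.finrank ℝ (Module.End.eigenspace (T a) δ) ≤
      Module.finrank ℝ (Module.End.eigenspace (T a) (-δ)) := by
    intro δ
    have hmaps : ∀ x ∈ Module.End.eigenspace (T a) δ, T b x ∈ Module.End.eigenspace (T a) (-δ) :=
      fun x hx => Module.End.mem_eigenspace_iff.2
        (hT.apply_of_eigen hab (Module.End.mem_eigenspace_iff.1 hx))
    refine LinearMap.finrank_le_finrank_of_injective (f := (T b).restrict hmaps) fun x y h => ?_
    have h' : T b x = T b y := congrArg Subtype.val h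
    exact Subtype.ext (by rw [← hT.sq b x, h', hT.sq])
  have hcompl : IsCompl (Module.End.eigenspace (T a) ε) (Module.End.eigenspace (T a) (-ε)) := by
    refine ⟨?_, ?_⟩
    · rw [Submodule.disjoint_def]
      intro x h1 h2
      exact inner_self_eq_zero.1 (hT.inner_eq_zero hε0 (Module.End.mem_eigenspace_iff.1 h1)
        (Module.End.mem_eigenspace_iff.1 h2))
    · rw [Submodule.codisjoint_iff_exists_add_eq]
      intro x
      refine ⟨(1 / 2 : ℝ) • (x + ε • T a x), (1 / 2 : ℝ) • (x - ε • T a x), ?_, ?_, by module⟩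
      · rw [Module.End.mem_eigenspace_iff]
        simp only [map_smul, map_add, hT.sq, smul_add, smul_smul]
        rw [show ε * (1 / 2 * ε) = 1 / 2 by linear_combination hε / 2]
        module
      · rw [Module.End.mem_eigenspace_iff]
        simp only [map_smul, map_sub, hT.sq, smul_sub, smul_smul]
        rw [show -ε * (1 / 2 * ε) = -(1 / 2) by linear_combination -hε / 2]
        module
  have h1 := Submodule.finrank_add_eq_of_isCompl hcompl
  have h2 := hle ε
  have h3 := hle (-ε)
  rw [neg_neg] at h3
  omega

end IsCliffordFamily

/-- The map `x ↦ (x + ε A x) / √2` for a linear map `A`. -/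
noncomputable def linFocal (ε : ℝ) (A : E →ₗ[ℝ] E) (x : E) : E :=
  (1 / Real.sqrt 2) • (x + ε • A x)

theorem one_div_sqrt_two_mul_self : (1 / Real.sqrt 2) * (1 / Real.sqrt 2) = 1 / 2 := by
  rw [div_mul_div_comm, Real.mul_self_sqrt zero_le_two, one_mul]

theorem linFocal_add_linFocal_neg (ε : ℝ) (A : E →ₗ[ℝ] E) (x : E) :
    (1 / Real.sqrt 2) • (linFocal ε A x + linFocal (-ε) A x) = x := by
  simp only [linFocal, ← smul_add, smul_smul, one_div_sqrt_two_mul_self]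
  module

theorem contDiff_linFocal [FiniteDimensional ℝ E] (ε : ℝ) (A : E →ₗ[ℝ] E) :
    ContDiff ℝ ∞ (linFocal ε A) := by
  have h : ContDiff ℝ ∞ A := A.toContinuousLinearMap.contDiff
  unfold linFocal
  fun_prop

theorem linFocal_of_eigen {A : E →ₗ[ℝ] E} {ε : ℝ} (hε : ε * ε = 1) {u v : E}
    (hu : A u = ε • u) (hv : A v = -ε • v) :
    linFocal ε A ((1 / Real.sqrt 2) • (u + v)) = u := by
  simp only [linFocal, map_smul, map_add, hu, hv]
  have hs := one_div_sqrt_two_mul_self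
  generalize 1 / Real.sqrt 2 = r at hs ⊢
  match_scalars
  · linear_combination (1 + ε * ε) * hs + hε / 2
  · linear_combination (1 - ε * ε) * hs - hε / 2

theorem norm_add_of_inner_eq_zero {u v : E} (hu : ‖u‖ = 1) (hv : ‖v‖ = 1) (h : inner ℝ u v = 0) :
    ‖(1 / Real.sqrt 2) • (u + v)‖ = 1 := by
  rw [← sq_eq_sq₀ (norm_nonneg _) zero_le_one, ← real_inner_self_eq_norm_sq]
  rw [real_inner_smul_left, real_inner_smul_right, ← mul_assoc, one_div_sqrt_two_mul_self,
    real_inner_self_eq_norm_sq, norm_add_sq_real, hu, hv, h]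
  norm_num

namespace IsCliffordFamily

variable {ι : Type*} {T : ι → E →ₗ[ℝ] E} (hT : IsCliffordFamily T)
include hT

theorem norm_apply (a : ι) (x : E) : ‖T a x‖ = ‖x‖ := by
  rw [← sq_eq_sq₀ (norm_nonneg _) (norm_nonneg _), ← real_inner_self_eq_norm_sq,
    hT.inner_self_apply, real_inner_self_eq_norm_sq]

theorem apply_linFocal (a : ι) {ε : ℝ} (hε : ε * ε = 1) (x : E) :
    T a (linFocal ε (T a) x) = ε • linFocal ε (T a) x := by
  simp only [linFocal, map_smul, map_add, hT.sq]
  match_scalars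
  · linear_combination -(1 / Real.sqrt 2) * hε
  · ring

theorem norm_linFocal {a : ι} {ε : ℝ} (hε : ε * ε = 1) {x : E} (hx : ‖x‖ = 1)
    (h : inner ℝ (T a x) x = 0) : ‖linFocal ε (T a) x‖ = 1 := by
  have hε1 : ‖ε‖ = 1 := by
    rw [← sq_eq_sq₀ (norm_nonneg _) zero_le_one, Real.norm_eq_abs, sq_abs, pow_two, hε, one_pow]
  refine norm_add_of_inner_eq_zero hx ?_ ?_
  · rw [norm_smul, hε1, hT.norm_apply, hx, one_mul]
  · rw [real_inner_smul_right, real_inner_comm, h, mul_zero]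

/-- The quadratic forms of the other members of the family in eigen-coordinates. -/
theorem inner_apply_of_eigen {a b : ι} (hab : a ≠ b) {ε : ℝ} (hε : ε * ε = 1) {u v : E}
    (hu : T a u = ε • u) (hv : T a v = -ε • v) :
    inner ℝ (T b ((1 / Real.sqrt 2) • (u + v))) ((1 / Real.sqrt 2) • (u + v)) =
      inner ℝ (T b u) v := by
  have hε0 : ε ≠ 0 := fun h => by simp [h] at hε
  -- The diagonal terms vanish since `T b` exchanges the orthogonal eigenspaces; the two cross terms
  -- agree by symmetry and absorb the factor `1/2`.
  rw [map_smul, real_inner_smul_left, real_inner_smul_right, ← mul_assoc,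
    one_div_sqrt_two_mul_self, map_add, inner_add_left, inner_add_right, inner_add_right,
    hT.inner_apply_self_of_eigen hab hε0 hu,
    hT.inner_apply_self_of_eigen hab (neg_ne_zero.2 hε0) hv, hT.symm b v u, real_inner_comm]
  ring

theorem inner_apply_eigen_self {a : ι} {ε : ℝ} (hε : ε * ε = 1) {u v : E}
    (hu : T a u = ε • u) (hv : T a v = -ε • v) (hu1 : ‖u‖ = 1) (hv1 : ‖v‖ = 1) :
    inner ℝ (T a ((1 / Real.sqrt 2) • (u + v))) ((1 / Real.sqrt 2) • (u + v)) = 0 := by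
  have hε0 : ε ≠ 0 := fun h => by simp [h] at hε
  have huv := hT.inner_eq_zero hε0 hu hv
  rw [map_smul, real_inner_smul_left, real_inner_smul_right, map_add, hu, hv]
  simp only [inner_add_left, inner_add_right, real_inner_smul_left, huv, real_inner_comm u v,
    real_inner_self_eq_norm_sq, hu1, hv1]
  ring

end IsCliffordFamily

end Clifford

theorem mem_unitSphere {n : ℕ} {x : Eucl n} : x ∈ unitSphere n ↔ ‖x‖ = 1 :=
  mem_sphere_zero_iff_norm

/-! ### Linear combinations of Clifford operators. -/

section CliffordCombinations

variable {E : Type*} [NormedAddCommGroup E] [InnerProductSpace ℝ E]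

/-- The combination `∑ c_j T_j` of a family of operators. -/
noncomputable def opCombination {k : ℕ} (T : Fin k → E →ₗ[ℝ] E) (c : Fin k → ℝ) : E →ₗ[ℝ] E :=
  ∑ j, c j • T j

theorem opCombination_apply {k : ℕ} (T : Fin k → E →ₗ[ℝ] E) (c : Fin k → ℝ) (x : E) :
    opCombination T c x = ∑ j, c j • T j x := by
  simp [opCombination]

namespace IsCliffordFamily

variable {ι : Type*} {T : ι → E →ₗ[ℝ] E} (hT : IsCliffordFamily T)
include hT

/-- The vectors `T (e i) x` are pairwise orthogonal of length `‖x‖`, so pairing with one of them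
extracts its coefficient. -/
theorem inner_opCombination_right {k : ℕ} {e : Fin k → ι} (he : Function.Injective e)
    (c : Fin k → ℝ) (x : E) (j : Fin k) :
    inner ℝ (T (e j) x) (opCombination (fun i => T (e i)) c x) = c j * inner ℝ x x := by
  rw [opCombination_apply, inner_sum, Finset.sum_eq_single j]
  · rw [real_inner_smul_right, hT.inner_self_apply]
  · intro i _ hij
    rw [real_inner_smul_right, hT.inner_apply_apply (he.ne hij.symm), mul_zero]
  · exact fun h => absurd (Finset.mem_univ j) h

theorem inner_sum_smul {k : ℕ} {e : Fin k → ι} (he : Function.Injective e) {u : E} (hu : ‖u‖ = 1)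
    (c : Fin k → ℝ) (j : Fin k) : inner ℝ (T (e j) u) (∑ i, c i • T (e i) u) = c j := by
  have h := hT.inner_opCombination_right he c u j
  rwa [opCombination_apply, real_inner_self_eq_norm_sq, hu, one_pow, mul_one] at h

theorem inner_opCombination_self {k : ℕ} {e : Fin k → ι} (he : Function.Injective e)
    (c : Fin k → ℝ) (x : E) :
    inner ℝ (opCombination (fun i => T (e i)) c x) (opCombination (fun i => T (e i)) c x) =
      (∑ j, c j ^ 2) * inner ℝ x x := by
  conv_lhs => enter [2]; rw [opCombination_apply]
  rw [sum_inner, Finset.sum_mul]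
  refine Finset.sum_congr rfl fun j _ => ?_
  rw [real_inner_smul_left, hT.inner_opCombination_right he]
  ring

/-- With `C` the combination, `‖C x‖²` and `⟨C x, x⟩` both equal the sum of squares, which is `1`;
hence `‖C x - x‖² = 1 - 2 + 1 = 0`. -/
theorem opCombination_fixed {k : ℕ} {e : Fin k → ι} (he : Function.Injective e) {x : E}
    (hx : ‖x‖ = 1) (h : ∑ j, inner ℝ (T (e j) x) x ^ 2 = (1 : ℝ)) :
    opCombination (fun i => T (e i)) (fun j => inner ℝ (T (e j) x) x) x = x := by
  have hxx : inner ℝ x x = (1 : ℝ) := by rw [real_inner_self_eq_norm_sq, hx]; norm_num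
  have h1 := hT.inner_opCombination_self he (fun j => inner ℝ (T (e j) x) x) x
  have h2 : inner ℝ (opCombination (fun i => T (e i)) (fun j => inner ℝ (T (e j) x) x) x) x =
      (1 : ℝ) := by
    rw [opCombination_apply, sum_inner, ← h]
    exact Finset.sum_congr rfl fun j _ => by rw [real_inner_smul_left, pow_two]
  rw [h, hxx] at h1
  rw [← sub_eq_zero, ← inner_self_eq_zero (𝕜 := ℝ), inner_sub_left, inner_sub_right,
    inner_sub_right, real_inner_comm _ x, h1, h2, hxx]
  norm_num

theorem apply_opCombination {k : ℕ} {e : Fin k → ι} {a : ι} (ha : ∀ j, a ≠ e j)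
    (c : Fin k → ℝ) (x : E) :
    T a (opCombination (fun i => T (e i)) c x) = -opCombination (fun i => T (e i)) c (T a x) := by
  simp only [opCombination_apply, map_sum, map_smul, ← Finset.sum_neg_distrib, ← smul_neg]
  exact Finset.sum_congr rfl fun j _ => by rw [hT.anticomm a (e j) (ha j)]

theorem inner_apply_opCombination {k : ℕ} {e : Fin k → ι} {a : ι} (ha : ∀ j, a ≠ e j)
    (c : Fin k → ℝ) (x : E) :
    inner ℝ (T a x) (opCombination (fun i => T (e i)) c x) = 0 := by
  rw [opCombination_apply, inner_sum]
  exact Finset.sum_eq_zero fun j _ => by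
    rw [real_inner_smul_right, hT.inner_apply_apply (ha j), mul_zero]

theorem exists_eigen_isometry [FiniteDimensional ℝ E] {l : ℕ}
    (hE : Module.finrank ℝ E = 2 * l) {a b : ι} (hab : a ≠ b) {ε : ℝ} (hε : ε * ε = 1) :
    ∃ κ : Eucl l →ₗᵢ[ℝ] E, ∀ y, T a y = ε • y ↔ ∃ c, κ c = y := by
  obtain ⟨κ, hκ⟩ := exists_linearIsometry_range _ (hT.finrank_eigenspace hE hab hε)
  exact ⟨κ, fun y => by rw [← hκ, Module.End.mem_eigenspace_iff]⟩

end IsCliffordFamily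

end CliffordCombinations

/-! ### Sum-of-squares sets: a global trivialization. -/

theorem image_eigen_isometry {l n : ℕ} {A : Eucl n →ₗ[ℝ] Eucl n} {ε : ℝ} {κ : Eucl l →ₗᵢ[ℝ] Eucl n}
    (hκ : ∀ y, A y = ε • y ↔ ∃ c, κ c = y) :
    κ '' unitSphere l = {x | ‖x‖ = 1 ∧ A x = ε • x} := by
  ext x
  simp only [Set.mem_image, mem_unitSphere, Set.mem_ofPred_eq, hκ]
  constructor
  · rintro ⟨c, hc, rfl⟩
    exact ⟨by rw [κ.norm_map, hc], c, rfl⟩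
  · rintro ⟨hx, c, rfl⟩
    exact ⟨c, by rw [← hx, κ.norm_map], rfl⟩

namespace IsCliffordFamily

variable {ι : Type*} {n : ℕ} {T : ι → Eucl n →ₗ[ℝ] Eucl n} (hT : IsCliffordFamily T)
include hT

/-- The focal fibration of the focal set `∑ ⟨T_j x, x⟩² = 1` is trivial. -/
theorem fibersOverSphere_sum_sq {l k : ℕ} (hn : n = 2 * l) {e : Fin k → ι}
    (he : Function.Injective e) {a b : ι} (ha : ∀ j, a ≠ e j) (hab : a ≠ b) {ε : ℝ}
    (hε : ε * ε = 1) :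
    FibersOverSphere l (linFocal ε (T a))
      {x | ‖x‖ = 1 ∧ ∑ j, inner ℝ (T (e j) x) x ^ 2 = (1 : ℝ)}
      {x | ‖x‖ = 1 ∧ T a x = ε • x} (unitSphere k) := by
  have hε0 : ε ≠ 0 := fun h => by simp [h] at hε
  have hT' : ∀ i, ContDiff ℝ ∞ (T i) := fun i => (T i).toContinuousLinearMap.contDiff
  obtain ⟨κ, hκ⟩ := hT.exists_eigen_isometry (by simpa using hn) hab hε
  have hκe : ∀ c, T a (κ c) = ε • κ c := fun c => (hκ _).2 ⟨c, rfl⟩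
  let p : Eucl n → Eucl l := fun x =>
    ContinuousLinearMap.adjoint κ.toContinuousLinearMap (linFocal ε (T a) x)
  have hκp : ∀ x, κ (p x) = linFocal ε (T a) x := by
    intro x
    obtain ⟨c, hc⟩ := (hκ _).1 (hT.apply_linFocal a hε x)
    simp only [p, ← hc, LinearIsometry.adjoint_apply_self]
  have hp : ContDiff ℝ ∞ p := (ContinuousLinearMap.contDiff _).comp (contDiff_linFocal ε (T a))
  refine ⟨κ, image_eigen_isometry hκ, p, fun x _ => hκp x, ?_⟩
  set J : Fin k → Eucl n →ₗ[ℝ] Eucl n := fun j => T (e j) with hJ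
  let γ : Eucl n → Eucl k := fun x => WithLp.toLp 2 fun j => inner ℝ (T (e j) x) x
  let Ψ : Eucl l × Eucl k → Eucl n := fun w =>
    (1 / Real.sqrt 2) • (κ w.1 + opCombination J w.2 (κ w.1))
  have hγ : ContDiff ℝ ∞ γ := by
    rw [contDiff_euclidean]
    exact fun j => (hT' (e j)).inner ℝ contDiff_id
  have hΨ : ContDiff ℝ ∞ Ψ := by
    have hκs : ContDiff ℝ ∞ fun w : Eucl l × Eucl k => κ w.1 := κ.contDiff.comp contDiff_fst
    simp only [Ψ, opCombination_apply]
    refine (hκs.add (ContDiff.sum fun j _ => ?_)).const_smul _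
    exact ((contDiff_euclidean.1 contDiff_snd) j).smul ((hT' (e j)).comp hκs)
  have hZ : ∀ x : Eucl n, ‖x‖ = 1 → ∑ j, inner ℝ (T (e j) x) x ^ 2 = (1 : ℝ) →
      ‖p x‖ = 1 ∧ ‖γ x‖ = 1 ∧ Ψ (p x, γ x) = x := by
    intro x hx hs
    have hfix := hT.opCombination_fixed he hx hs
    -- `x` is a combination of the `T (e j) x`, all of which are orthogonal to `T a x`.
    have h0 : inner ℝ (T a x) x = 0 := by
      have h := hT.inner_apply_opCombination ha (fun j => inner ℝ (T (e j) x) x) x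
      rwa [hfix] at h
    refine ⟨by rw [← κ.norm_map, hκp, hT.norm_linFocal hε hx h0], ?_, ?_⟩
    · rw [EuclideanSpace.norm_eq]
      simp only [γ, Real.norm_eq_abs, sq_abs, hs, Real.sqrt_one]
    -- The combination fixes `x` and anticommutes with `T a`, so it sends `T a x` to `-T a x` and
    -- thus exchanges the two focal images of `x`.
    · have h : opCombination J (γ x) (linFocal ε (T a) x) = linFocal (-ε) (T a) x := by
        have h1 := hT.apply_opCombination ha (fun j => inner ℝ (T (e j) x) x) x
        rw [hfix, eq_comm, neg_eq_iff_eq_neg] at h1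
        simp only [linFocal, map_smul, map_add, γ, hJ, hfix, h1]
        module
      simp only [Ψ, hκp, h]
      exact linFocal_add_linFocal_neg ε (T a) x
  have hS : ∀ w : Eucl l × Eucl k, ‖w.1‖ = 1 → ‖w.2‖ = 1 →
      ‖Ψ w‖ = 1 ∧ p (Ψ w) = w.1 ∧ γ (Ψ w) = w.2 := by
    rintro ⟨u, c⟩ hu hc
    simp only at hu hc
    have hκ1 : ‖κ u‖ = 1 := by rw [κ.norm_map, hu]
    have hκκ : inner ℝ (κ u) (κ u) = (1 : ℝ) := by
      rw [real_inner_self_eq_norm_sq, hκ1]; norm_num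
    have hv : T a (opCombination J c (κ u)) = -ε • opCombination J c (κ u) := by
      rw [hT.apply_opCombination ha, hκe, map_smul, neg_smul]
    have hc' : ∑ j, c j ^ 2 = 1 := by
      rw [EuclideanSpace.norm_eq, Real.sqrt_eq_one] at hc
      simpa only [Real.norm_eq_abs, sq_abs] using hc
    have hv1 : ‖opCombination J c (κ u)‖ = 1 := by
      rw [← sq_eq_sq₀ (norm_nonneg _) zero_le_one, ← real_inner_self_eq_norm_sq,
        hT.inner_opCombination_self he, hc', hκκ]
      norm_num
    refine ⟨norm_add_of_inner_eq_zero hκ1 hv1 (hT.inner_eq_zero hε0 (hκe u) hv), ?_, ?_⟩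
    · refine κ.injective ?_
      rw [hκp]
      exact linFocal_of_eigen hε (hκe u) hv
    · ext j
      simp only [γ, Ψ]
      rw [hT.inner_apply_of_eigen (ha j) hε (hκe u) hv, hT.inner_opCombination_right he, hκκ,
        mul_one]
  refine ⟨fun x hx => mem_unitSphere.2 (hZ x hx.1 hx.2).1, hp.smoothOnSubset _, fun b _ =>
    ⟨Set.univ, isOpen_univ, Set.mem_univ b, fun x => (p x, γ x), Ψ,
      (hp.prodMk hγ).smoothOnSubset _, hΨ.smoothOnSubset _, ?_, ?_, ⟨?_, ?_⟩, fun _ _ => rfl⟩⟩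
  · rintro x ⟨hx, -⟩
    obtain ⟨h1, h2, -⟩ := hZ x hx.1 hx.2
    exact ⟨⟨mem_unitSphere.2 h1, Set.mem_univ _⟩, mem_unitSphere.2 h2⟩
  · rintro w ⟨⟨h1, -⟩, h2⟩
    obtain ⟨h3, -, h4⟩ := hS w (mem_unitSphere.1 h1) (mem_unitSphere.1 h2)
    refine ⟨⟨h3, ?_⟩, Set.mem_univ _⟩
    have h5 := mem_unitSphere.1 h2
    rw [← h4, EuclideanSpace.norm_eq, Real.sqrt_eq_one] at h5
    simpa only [γ, Real.norm_eq_abs, sq_abs] using h5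
  · rintro x ⟨hx, -⟩
    exact (hZ x hx.1 hx.2).2.2
  · rintro w ⟨⟨h1, -⟩, h2⟩
    obtain ⟨-, h3, h4⟩ := hS w (mem_unitSphere.1 h1) (mem_unitSphere.1 h2)
    exact Prod.ext h3 h4

end IsCliffordFamily

/-! ### Common zero sets: the bundle of normal vectors. -/

namespace IsCliffordFamily

section Projection

variable {E : Type*} [NormedAddCommGroup E] [InnerProductSpace ℝ E] [FiniteDimensional ℝ E]

/-- The projection onto the vectors of the `-ε`-eigenspace of `A` that are orthogonal
to all `J_j u`. -/
noncomputable def normalProjection {k : ℕ} (ε : ℝ) (A : E →ₗ[ℝ] E) (J : Fin k → E →ₗ[ℝ] E)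
    (u : E) : E →L[ℝ] E :=
  (1 / 2 : ℝ) • (1 - ε • A.toContinuousLinearMap) -
    ∑ j, (innerSL ℝ (J j u)).smulRight (J j u)

theorem normalProjection_apply {k : ℕ} (ε : ℝ) (A : E →ₗ[ℝ] E) (J : Fin k → E →ₗ[ℝ] E)
    (u y : E) : normalProjection ε A J u y =
      (1 / 2 : ℝ) • (y - ε • A y) - ∑ j, inner ℝ (J j u) y • J j u := by
  simp [normalProjection]

theorem contDiff_normalProjection {k : ℕ} (ε : ℝ) (A : E →ₗ[ℝ] E) (J : Fin k → E →ₗ[ℝ] E) :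
    ContDiff ℝ ∞ (normalProjection ε A J) := by
  have hJ : ∀ j, ContDiff ℝ ∞ (J j) := fun j => (J j).toContinuousLinearMap.contDiff
  unfold normalProjection
  exact contDiff_const.sub (ContDiff.sum fun j _ =>
    ((innerSL ℝ).contDiff.comp (hJ j)).smulRight (hJ j))

variable {ι : Type*} {T : ι → E →ₗ[ℝ] E} (hT : IsCliffordFamily T)
include hT

section

variable {k : ℕ} {e : Fin k → ι} (he : Function.Injective e) {a : ι} (ha : ∀ j, a ≠ e j) {ε : ℝ}
  (hε : ε * ε = 1) {u : E} (hu : ‖u‖ = 1) (hAu : T a u = ε • u)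
include he ha hε hu hAu

omit he hu in
theorem apply_normalProjection (y : E) :
    T a (normalProjection ε (T a) (fun j => T (e j)) u y) =
      -ε • normalProjection ε (T a) (fun j => T (e j)) u y := by
  simp only [normalProjection_apply, map_sub, map_smul, map_sum, hT.sq,
    fun j => hT.apply_of_eigen (ha j) hAu, smul_sub, Finset.smul_sum, smul_comm _ (-ε)]
  congr 1
  match_scalars
  · linear_combination -hε / 2
  · ring

/-- The `T (e j) u` are orthonormal and lie in the `-ε`-eigenspace, so pairing with one gives the
same value on `y` as on its eigencomponent `(y - ε • T a y) / 2`; the subtracted sum cancels it. -/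
theorem inner_normalProjection (y : E) (j : Fin k) :
    inner ℝ (T (e j) u) (normalProjection ε (T a) (fun j => T (e j)) u y) = 0 := by
  rw [normalProjection_apply, inner_sub_right, hT.inner_sum_smul he hu, real_inner_smul_right,
    inner_sub_right, real_inner_smul_right, ← hT.symm a, hT.apply_of_eigen (ha j) hAu,
    real_inner_smul_left]
  linear_combination hε / 2 * inner ℝ (T (e j) u) y

theorem normalProjection_eq_self_iff (v : E) :
    normalProjection ε (T a) (fun j => T (e j)) u v = v ↔
      T a v = -ε • v ∧ ∀ j, inner ℝ (T (e j) u) v = 0 := by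
  constructor
  · intro h
    rw [← h]
    exact ⟨hT.apply_normalProjection ha hε hAu v,
      hT.inner_normalProjection he ha hε hu hAu v⟩
  · rintro ⟨h1, h2⟩
    simp only [normalProjection_apply, h1, h2, zero_smul, Finset.sum_const_zero, sub_zero,
      smul_smul, mul_neg, hε]
    module

theorem normalProjection_mul_self :
    normalProjection ε (T a) (fun j => T (e j)) u * normalProjection ε (T a) (fun j => T (e j)) u =
      normalProjection ε (T a) (fun j => T (e j)) u := by
  ext y
  exact (hT.normalProjection_eq_self_iff he ha hε hu hAu _).2
    ⟨hT.apply_normalProjection ha hε hAu y, hT.inner_normalProjection he ha hε hu hAu y⟩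

/-- The fixed space is the orthogonal complement, within the `l`-dimensional `-ε`-eigenspace, of the
span of `k` orthonormal vectors. Their existence forces `k ≤ l`, so the subtraction `l - k` is not
truncated here. -/
theorem exists_normalProjection_isometry {l : ℕ} (hE : Module.finrank ℝ E = 2 * l) {b : ι}
    (hab : a ≠ b) : ∃ κ : Eucl (l - k) →ₗᵢ[ℝ] E, ∀ y,
      normalProjection ε (T a) (fun j => T (e j)) u y = y ↔ ∃ c, κ c = y := by
  set K := Submodule.span ℝ (Set.range fun j => T (e j) u) with hK
  set V := Module.End.eigenspace (T a) (-ε) with hV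
  have hKV : K ≤ V := Submodule.span_le.2 <| Set.range_subset_iff.2 fun j =>
    Module.End.mem_eigenspace_iff.2 (hT.apply_of_eigen (ha j) hAu)
  have hon : Orthonormal ℝ fun j => T (e j) u :=
    ⟨fun j => by rw [hT.norm_apply, hu], fun i j hij => hT.inner_apply_apply (he.ne hij) u⟩
  have hKk : Module.finrank ℝ K = k := by
    rw [hK, finrank_span_eq_card hon.linearIndependent, Fintype.card_fin]
  have hVl : Module.finrank ℝ V = l :=
    hT.finrank_eigenspace hE hab (by linear_combination hε)
  have hrank : Module.finrank ℝ ↥(Kᗮ ⊓ V) = l - k := by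
    have := Submodule.finrank_add_inf_finrank_orthogonal hKV
    omega
  obtain ⟨κ, hκ⟩ := exists_linearIsometry_range _ hrank
  refine ⟨κ, fun y => ?_⟩
  rw [← hκ, hT.normalProjection_eq_self_iff he ha hε hu hAu, Submodule.mem_inf,
    Module.End.mem_eigenspace_iff, and_comm]
  refine and_congr_left fun _ => ⟨fun h => ?_, fun h j => ?_⟩
  · have hle : K ≤ (ℝ ∙ y)ᗮ := Submodule.span_le.2 <| Set.range_subset_iff.2 fun j =>
      Submodule.mem_orthogonal_singleton_iff_inner_left.2 (h j)
    exact (Submodule.mem_orthogonal _ _).2 fun w hw =>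
      Submodule.mem_orthogonal_singleton_iff_inner_left.1 (hle hw)
  · exact (Submodule.mem_orthogonal _ _).1 h _ (Submodule.subset_span ⟨j, rfl⟩)

end

end Projection

variable {ι : Type*} {n : ℕ} {T : ι → Eucl n →ₗ[ℝ] Eucl n} (hT : IsCliffordFamily T)
include hT

/-- The focal fibration of the common zero set of the quadratic forms. -/
theorem fibersOverSphere_zero {l k : ℕ} (hn : n = 2 * l) {e : Fin k → ι}
    (he : Function.Injective e) {a b : ι} (ha : ∀ j, a ≠ e j) (hab : a ≠ b) {ε : ℝ}
    (hε : ε * ε = 1) :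
    FibersOverSphere l (linFocal ε (T a))
      {x | ‖x‖ = 1 ∧ inner ℝ (T a x) x = (0 : ℝ) ∧ ∀ j, inner ℝ (T (e j) x) x = (0 : ℝ)}
      {x | ‖x‖ = 1 ∧ T a x = ε • x} (unitSphere (l - k)) := by
  have hε0 : ε ≠ 0 := fun h => by simp [h] at hε
  have hε' : -ε * -ε = 1 := by linear_combination hε
  have hE : Module.finrank ℝ (Eucl n) = 2 * l := by simpa using hn
  obtain ⟨κ, hκ⟩ := hT.exists_eigen_isometry hE hab hε
  have hκe : ∀ c, T a (κ c) = ε • κ c := fun c => (hκ _).2 ⟨c, rfl⟩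
  let p : Eucl n → Eucl l := fun x =>
    ContinuousLinearMap.adjoint κ.toContinuousLinearMap (linFocal ε (T a) x)
  have hκp : ∀ x, κ (p x) = linFocal ε (T a) x := by
    intro x
    obtain ⟨c, hc⟩ := (hκ _).1 (hT.apply_linFocal a hε x)
    simp only [p, ← hc, LinearIsometry.adjoint_apply_self]
  have hp : ContDiff ℝ ∞ p := (ContinuousLinearMap.contDiff _).comp (contDiff_linFocal ε (T a))
  have hκ1 : ∀ u ∈ unitSphere l, ‖κ u‖ = 1 := fun u hu => by
    rw [κ.norm_map, mem_unitSphere.1 hu]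
  refine ⟨κ, image_eigen_isometry hκ, p, fun x _ => hκp x, ?_⟩
  -- The fiber coordinate is the opposite focal image `v`, and `s` reassembles `x = (u + v)/√2`.
  refine isSmoothFibration_of_idempotents (q := linFocal (-ε) (T a))
    (s := fun w => (1 / Real.sqrt 2) • (κ w.1 + w.2))
    (Q := fun u => normalProjection ε (T a) (fun j => T (e j)) (κ u)) hp
    (contDiff_linFocal _ _) (((κ.contDiff.comp contDiff_fst).add contDiff_snd).const_smul _)
    ((contDiff_normalProjection _ _ _).comp κ.contDiff)
    (fun u hu => hT.normalProjection_mul_self he ha hε (hκ1 u hu) (hκe u))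
    (fun u hu => hT.exists_normalProjection_isometry he ha hε (hκ1 u hu) (hκe u) hE hab) ?_ ?_
  · rintro x ⟨hx, hax, hjx⟩
    have hpx : p x ∈ unitSphere l := by
      rw [mem_unitSphere, ← κ.norm_map, hκp, hT.norm_linFocal hε hx hax]
    have hq := hT.apply_linFocal a hε' x
    refine ⟨hpx, ?_, hT.norm_linFocal hε' hx hax, ?_⟩
    · refine (hT.normalProjection_eq_self_iff he ha hε (hκ1 _ hpx) (hκe _) _).2
        ⟨hq, fun j => ?_⟩
      rw [← hT.inner_apply_of_eigen (ha j) hε (hκe _) hq, hκp, linFocal_add_linFocal_neg, hjx]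
    · simp only [hκp, linFocal_add_linFocal_neg]
  · intro u hu v hv hv1
    obtain ⟨hav, hjv⟩ := (hT.normalProjection_eq_self_iff he ha hε (hκ1 u hu) (hκe u) v).1 hv
    refine ⟨⟨norm_add_of_inner_eq_zero (hκ1 u hu) hv1 (hT.inner_eq_zero hε0 (hκe u) hav),
      hT.inner_apply_eigen_self hε (hκe u) hav (hκ1 u hu) hv1, fun j => ?_⟩, ?_, ?_⟩
    · rw [hT.inner_apply_of_eigen (ha j) hε (hκe u) hav, hjv]
    · exact κ.injective (by rw [hκp, linFocal_of_eigen hε (hκe u) hav])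
    · have h := linFocal_of_eigen hε' hav (by rw [neg_neg]; exact hκe u)
      rwa [add_comm] at h

end IsCliffordFamily

/-! ### From matrices to operators, and the final statement. -/

theorem IsSymmetricCliffordSystem.isCliffordFamily {l m : ℕ}
    {P : Fin (m + 1) → Matrix (Fin (2 * l)) (Fin (2 * l)) ℝ} (hP : IsSymmetricCliffordSystem P) :
    IsCliffordFamily fun a => Matrix.toEuclideanLin (P a) := by
  have hmul : ∀ (a b) (x : Eucl (2 * l)), Matrix.toEuclideanLin (P a * P b) x =
      Matrix.toEuclideanLin (P a) (Matrix.toEuclideanLin (P b) x) := fun a b x => by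
    simp [Matrix.toLpLin_apply]
  have hac : ∀ (a b) (x : Eucl (2 * l)),
      Matrix.toEuclideanLin (P a) (Matrix.toEuclideanLin (P b) x) +
        Matrix.toEuclideanLin (P b) (Matrix.toEuclideanLin (P a) x) =
      (if a = b then (2 : ℝ) else 0) • x := fun a b x => by
    rw [← hmul, ← hmul, ← LinearMap.add_apply, ← map_add, hP.anticomm]
    split_ifs <;> simp
  refine ⟨fun a x y => ?_, fun a x => ?_, fun a b hab x => ?_⟩
  · have h : (P a).IsHermitian := by
      rw [Matrix.IsHermitian, Matrix.conjTranspose_eq_transpose_of_trivial]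
      exact hP.symm a
    exact Matrix.isSymmetric_toEuclideanLin_iff.2 h x y
  · have h := hac a a x
    rw [if_pos rfl, ← two_smul ℝ] at h
    exact smul_right_injective _ (two_ne_zero' ℝ) h
  · have h := hac a b x
    rw [if_neg hab, zero_smul] at h
    exact eq_neg_of_add_eq_zero_left h

theorem filter_le_eq_map_castLEEmb {i m : ℕ} (h : i + 1 ≤ m + 1) :
    Finset.univ.filter (fun a : Fin (m + 1) => (a : ℕ) ≤ i) =
      Finset.univ.map (Fin.castLEEmb h) := by
  ext a
  simp only [Finset.mem_filter, Finset.mem_univ, true_and, Finset.mem_map]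
  exact ⟨fun ha => ⟨⟨a, Nat.lt_succ_of_le ha⟩, rfl⟩,
    by rintro ⟨j, rfl⟩; exact Nat.le_of_lt_succ j.2⟩

theorem corollary1p2 (l m : ℕ) (P : Fin (m + 1) → Matrix (Fin (2 * l)) (Fin (2 * l)) ℝ)
    (hP : IsSymmetricCliffordSystem P) :
    (∀ (i : ℕ) (hi : i + 1 ≤ m) (ε : ℝ), ε = 1 ∨ ε = -1 →
      FibersOverSphere l (focalMap ε (P ⟨i + 1, Nat.lt_succ_of_le hi⟩)) (setM P (i + 1))
        {x | x ∈ setM P i ∧ quadForm (P ⟨i + 1, Nat.lt_succ_of_le hi⟩) x = ε}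
        (unitSphere (l - (i + 1)))) ∧
    (∀ (i : ℕ) (_ : 2 ≤ i) (hi : i ≤ m) (ε : ℝ), ε = 1 ∨ ε = -1 →
      FibersOverSphere l (focalMap ε (P ⟨i, Nat.lt_succ_of_le hi⟩)) (setN P (i - 1))
        {x | x ∈ setN P i ∧ quadForm (P ⟨i, Nat.lt_succ_of_le hi⟩) x = ε}
        (unitSphere i)) := by
  have hT := hP.isCliffordFamily
  set T : Fin (m + 1) → Eucl (2 * l) →ₗ[ℝ] Eucl (2 * l) := fun a => Matrix.toEuclideanLin (P a)
    with hTdef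
  have hquad : ∀ a x, quadForm (P a) x = inner ℝ (T a x) x := fun _ _ => rfl
  have hεε : ∀ {ε : ℝ}, ε = 1 ∨ ε = -1 → ε * ε = 1 := by rintro ε (rfl | rfl) <;> norm_num
  have hfocal : ∀ (ε : ℝ) a, focalMap ε (P a) = linFocal ε (T a) := fun _ _ => rfl
  constructor
  · intro i hi ε hε
    have hε := hεε hε
    have hε0 : ε ≠ 0 := fun h => by simp [h] at hε
    have hle : i + 1 ≤ m + 1 := hi.trans (Nat.le_succ m)
    set a : Fin (m + 1) := ⟨i + 1, Nat.lt_succ_of_le hi⟩ with ha_def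
    have ha : ∀ j, a ≠ Fin.castLEEmb hle j := fun j h => j.2.ne' (congrArg Fin.val h)
    rw [hfocal]
    -- `P_0` serves as the auxiliary operator exchanging the eigenspaces of `P_{i+1}`.
    convert hT.fibersOverSphere_zero rfl (Fin.castLEEmb hle).injective ha (ha 0) hε using 1
    · ext x
      simp only [setM, mem_unitSphere, hquad, Set.mem_ofPred_eq]
      refine and_congr_right fun _ => ⟨fun h => ⟨h a le_rfl, fun j => h _ j.2.le⟩, ?_⟩
      rintro ⟨h1, h2⟩ b hb
      rcases Nat.le_succ_iff.1 hb with hb | hb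
      · exact h2 ⟨b, Nat.lt_succ_of_le hb⟩
      · rwa [show b = a from Fin.ext hb]
    · ext x
      simp only [setM, mem_unitSphere, hquad, Set.mem_ofPred_eq, and_assoc]
      refine and_congr_right fun hx => ?_
      rw [hT.inner_apply_self_eq_iff hε hx]
      -- On eigenvectors of `T a` every other quadratic form of the family vanishes, so the focal
      -- set is the whole unit sphere of the eigenspace.
      refine ⟨And.right, fun h => ⟨fun b hb => ?_, h⟩⟩
      have hab : a ≠ b := fun hab => by subst hab; exact absurd hb (Nat.not_succ_le_self i)
      exact hT.inner_apply_self_of_eigen hab hε0 h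
  · intro i hi2 hi ε hε
    have hε := hεε hε
    have hε0 : ε ≠ 0 := fun h => by simp [h] at hε
    obtain ⟨k, rfl⟩ : ∃ k, i = k + 1 := ⟨i - 1, by omega⟩
    have hle : k + 1 ≤ m + 1 := hi.trans (Nat.le_succ m)
    set a : Fin (m + 1) := ⟨k + 1, Nat.lt_succ_of_le hi⟩ with ha_def
    have ha : ∀ j, a ≠ Fin.castLEEmb hle j := fun j h => j.2.ne' (congrArg Fin.val h)
    rw [hfocal]
    convert hT.fibersOverSphere_sum_sq rfl (Fin.castLEEmb hle).injective ha (ha 0) hε using 1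
    · ext x
      simp only [setN, mem_unitSphere, hquad, Set.mem_ofPred_eq, Nat.add_sub_cancel,
        filter_le_eq_map_castLEEmb hle, Finset.sum_map]
    · ext x
      simp only [setN, mem_unitSphere, hquad, Set.mem_ofPred_eq, and_assoc]
      refine and_congr_right fun hx => ?_
      rw [hT.inner_apply_self_eq_iff hε hx]
      refine ⟨And.right, fun h => ⟨?_, h⟩⟩
      -- On an eigenvector only the form of `T a` survives, contributing `ε² = 1`.
      rw [Finset.sum_eq_single a]
      · rw [(hT.inner_apply_self_eq_iff hε hx).2 h, pow_two, hε]
      · intro b _ hba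
        rw [hT.inner_apply_self_of_eigen hba.symm hε0 h, zero_pow two_ne_zero]
      · refine fun h => (h ?_).elim
        simp only [Finset.mem_filter, Finset.mem_univ, true_and, ha_def, le_refl]
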